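/- **Theorem.** Let $r\ge 1$ and let $\zeta\in\mathbb{C}$ be a primitive $r$-th root of unity. Let $G_{r,n}=\mathbb{Z}_r\wr S_n$ be the group of permutations $\pi$ of $[n]\times\mathbb{Z}/r\mathbb{Z}$ such that $\pi(a,0)=(b,j)$ implies $\pi(a,i)=(b,i+j)$ for all $i$. Write $\pi\in G_{r,n}$ as the colored word $(\pi_1,\dots,\pi_n)=(\sigma_1^{z_1},\dots,\sigma_n^{z_n})$, where $\pi(i,0)=(\sigma_i,z_i)$, $\sigma=(\sigma_1,\dots,\sigma_n)\in S_n$ and $z_i\in\{0,\dots,r-1\}$; a letter of color $0$ is written without its color. Put $$\mathrm{inv}(|\pi|)=\#\{i<j:\sigma_i>\sigma_j\},\qquad \mathrm{col}(\pi)=z_1+\cdots+z_n,\qquad \mathrm{fmaj}(\pi)=r\sum_{1\le i\le n-1,\ \pi_i>\pi_{i+1}} i+\mathrm{col}(\pi),$$ where colored integers are compared in the order $1^{r-1}<\cdots<n^{r-1}<\cdots<1^{1}<\cdots<n^{1}<1<\cdots<n$. For $\epsilon\in\{1,-1\}$ and $0\le h\le r-1$, let $\chi_{\epsilon,h}(\pi)=\epsilon^{\mathrm{inv}(|\pi|)}\zeta^{h\cdot\mathrm{col}(\pi)}$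 be the corresponding one-dimensional character of $G_{r,n}$. Let $G_{r,n}(a:b)$ be the set of $\pi\in G_{r,n}$ whose colored word contains $(a,a+1,\dots,b)$, all letters having color $0$, as a (not necessarily contiguous) subsequence. Write $[m]_x=1+x+\cdots+x^{m-1}$, and let $q$ be an indeterminate. Let $1\le k\le n-1$ and $k\le b\le n$ with $b\equiv n\pmod 2$. Then the following identities hold in $\mathbb{C}[q]$. 1. If $n-k$ is even, then $$\sum_{\pi\in G_{r,n}(b-k+1\,:\,b)}\chi_{\epsilon,h}(\pi)\,q^{\mathrm{fmaj}(\pi)}=\prod_{i=k+1}^{n}[ir]_{\epsilon^{i-1}\zeta^h q}.$$ 2. If $n-k$ is odd, then $$\sum_{\pi\in G_{r,n}(b-k+1\,:\,b)}\chi_{\epsilon,h}(\pi)\,q^{\mathrm{fmaj}(\pi)}=[k+1]_{\epsilon q^r}\,[r]_{\zeta^h q}\prod_{i=k+2}^{n}[ir]_{\epsilon^{i-1}\zeta^h q}.$$ -/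

import Mathlib

open Polynomial

namespace ColoredPermutation

/-- The colored permutation group `G_{r,n} = ℤ_r ≀ S_n`: the permutations `π` of `[n] × ℤ/r` such
that `π (a, 0) = (b, j)` implies `π (a, i) = (b, i + j)` for all `i`, under composition.
The element `a : Fin n` stands for the integer `a + 1` of `[n] = {1, …, n}`. -/
def G (r n : ℕ) : Subgroup (Equiv.Perm (Fin n × ZMod r)) where
  carrier := {π | ∀ a b j, π (a, 0) = (b, j) → ∀ i, π (a, i) = (b, i + j)}
  one_mem' := by
    intro a b j h i
    simp only [Equiv.Perm.coe_one, id_eq, Prod.mk.injEq] at h ⊢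
    obtain ⟨rfl, rfl⟩ := h
    simp
  mul_mem' := by
    intro π τ hπ hτ a b j h i
    have h1 := hτ a _ _ rfl
    have h2 := hπ (τ.1 (a, 0)).1 _ _ rfl
    rw [Equiv.Perm.mul_apply, h1, h2] at h
    rw [Equiv.Perm.mul_apply, h1, h2]
    simp only [Prod.mk.injEq] at h ⊢
    exact ⟨h.1, by rw [← h.2, zero_add, add_assoc]⟩
  inv_mem' := by
    intro π hπ a b j h i
    have h1 := hπ b _ _ rfl
    rw [Equiv.Perm.inv_eq_iff_eq, h1] at h
    rw [Equiv.Perm.inv_eq_iff_eq, h1]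
    simp only [Prod.mk.injEq] at h ⊢
    exact ⟨h.1, by rw [add_assoc, ← h.2, add_zero]⟩

variable {r n : ℕ}

/-- The absolute value `|π_i| = σ_i ∈ {1, …, n}` of the `i`-th letter `π_i = π (i, 0)`. -/
def absVal (π : G r n) (i : Fin n) : ℕ := (π.1 (i, 0)).1.val + 1

/-- The color `z_i` of the `i`-th letter; it lies in `{0, …, r - 1}` when `r ≥ 1`. -/
def color (π : G r n) (i : Fin n) : ℕ := (π.1 (i, 0)).2.val

/-- The colored word (window notation) of `π`: the list of the letters `σ_i ^ {z_i}`, each written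
as the pair `(σ_i, z_i)`. -/
def window (π : G r n) : List (ℕ × ℕ) := List.ofFn fun i => (absVal π i, color π i)

/-- The inversion number of `|π|`. -/
def inv (π : G r n) : ℕ :=
  (Finset.univ.filter fun p : Fin n × Fin n =>
    p.1 < p.2 ∧ absVal π p.1 > absVal π p.2).card

/-- The color weight `z_1 + ⋯ + z_n`. -/
def col (π : G r n) : ℕ := ∑ i, color π i

/-- The linear order `1^{r-1} < ⋯ < n^{r-1} < ⋯ < 1^1 < ⋯ < n^1 < 1 < ⋯ < n` on colored integers
(value, color): larger colors come first, and equal colors are ordered by value. -/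
def ltF (x y : ℕ × ℕ) : Prop := y.2 < x.2 ∨ (x.2 = y.2 ∧ x.1 < y.1)

instance : DecidableRel ltF := fun _ _ => inferInstanceAs (Decidable (_ ∨ _))

/-- The major index with respect to the order `F`: the sum of the positions `i ∈ {1, …, n - 1}`
with `π_i > π_{i+1}`. Position `i + 1` is the index `i : Fin n`. -/
def majF (π : G r n) : ℕ :=
  ∑ i ∈ Finset.univ.filter fun i : Fin n =>
    ∃ j : Fin n, j.val = i.val + 1 ∧
      ltF (absVal π j, color π j) (absVal π i, color π i), (i.val + 1)

/-- The flag major index. -/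
def fmaj (π : G r n) : ℕ := r * majF π + col π

/-- The one-dimensional character `χ_{ε,h}(π) = ε^{inv |π|} ζ^{h col π}`, where `ζ` is the fixed
primitive `r`-th root of unity. -/
def chi (ζ ε : ℂ) (h : ℕ) (π : G r n) : ℂ := ε ^ inv π * ζ ^ (h * col π)

/-- The set `G_{r,n}(a : b)` of colored permutations whose colored word contains
`(a, a + 1, …, b)` (all letters of color `0`) as a subsequence. -/
noncomputable def withSubseq (r n : ℕ) [NeZero r] (a b : ℕ) : Finset (G r n) :=
  (Set.toFinite {π : G r n |
    ((List.range' a (b + 1 - a)).map fun m => (m, 0)).Sublist (window π)}).toFinset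

/-- The `q`-integer `[m]_x = 1 + x + ⋯ + x^{m-1}`, evaluated at a polynomial `x`. -/
noncomputable def qInt (m : ℕ) (x : ℂ[X]) : ℂ[X] := ∑ i ∈ Finset.range m, x ^ i

end ColoredPermutation

/-! Put `x = ζ^h q`. Since `ζ^r = 1`, each summand equals `ε^inv x^fmaj`, so the character only adds
the sign. Windows are read backwards: prepending a letter to the list appends it to the word, so no
existing descent moves and inductions on lists apply.

A word containing the prescribed block arises from the block by inserting the missing values with
arbitrary colors, and the order of insertion may be chosen freely. For `ε = 1`, one insertion into a
word of length `l` multiplies the sum by `[(l+1)r]_x`. For `ε = -1` a single insertion has no such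
factor in general, so `a` and `a + 1` are inserted together. Exchanging them reverses the sign and
keeps `fmaj`, unless they are adjacent with equal colors; all other terms cancel. The surviving
terms sum to `[(l+1)r]_{±x} [(l+2)r]_{∓x}` (`sum_wordWeight_insertLetter_pair`), which is the
product claimed.

As `n - b` is even, the values above the block split into such pairs. The `b - k` values below it do
too, except for one leftover when `n - k` is odd. That leftover, taken to be `b - k`, is inserted
into the bare block first, where its contribution is computed directly
(`sum_wordWeight_extensions_singleton`). -/

namespace ColoredPermutation

/-! ### Statistics and insertion on reversed colored words. -/

/-- The inversion number of the reversal of a colored word. -/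
def wordInv : List (ℕ × ℕ) → ℕ
  | [] => 0
  | c :: w => w.countP (fun d => c.1 < d.1) + wordInv w

/-- The major index of the reversal of a colored word. -/
def wordMaj : List (ℕ × ℕ) → ℕ
  | [] => 0
  | [_] => 0
  | c :: d :: w => wordMaj (d :: w) + if ltF c d then w.length + 1 else 0

/-- The color weight of a colored word. -/
def wordCol (w : List (ℕ × ℕ)) : ℕ := (w.map Prod.snd).sum

/-- The signed flag major index monomial of the reversal of a colored word. -/
def wordWeight {R : Type*} [CommRing R] (r : ℕ) (e x : R) (w : List (ℕ × ℕ)) : R :=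
  e ^ wordInv w * x ^ (r * wordMaj w + wordCol w)

/-- Insert the letter `c` in the `i`-th gap of `w`. -/
def insertLetter (i : ℕ) (c : ℕ × ℕ) (w : List (ℕ × ℕ)) : List (ℕ × ℕ) := w.take i ++ c :: w.drop i

theorem insertLetter_zero (c : ℕ × ℕ) (w) : insertLetter 0 c w = c :: w := rfl

theorem insertLetter_succ_cons (i : ℕ) (c d : ℕ × ℕ) (w) :
    insertLetter (i + 1) c (d :: w) = d :: insertLetter i c w := rfl

theorem length_insertLetter (i : ℕ) (c : ℕ × ℕ) (w) :
    (insertLetter i c w).length = w.length + 1 := by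
  simp [insertLetter]; omega

theorem mem_insertLetter {i : ℕ} {c d : ℕ × ℕ} {w} : d ∈ insertLetter i c w ↔ d = c ∨ d ∈ w := by
  conv_rhs => rw [← List.take_append_drop i w]
  simp only [insertLetter, List.mem_append, List.mem_cons]; tauto

theorem wordMaj_cons_cons (c d : ℕ × ℕ) (w) :
    wordMaj (c :: d :: w) = wordMaj (d :: w) + if ltF c d then w.length + 1 else 0 := rfl

theorem wordCol_insertLetter (i : ℕ) (c : ℕ × ℕ) (w) :
    wordCol (insertLetter i c w) = wordCol w + c.2 := by
  conv_rhs => rw [← List.take_append_drop i w]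
  simp only [wordCol, insertLetter, List.map_append, List.sum_append, List.map_cons, List.sum_cons]
  omega

theorem ltF_trans {c d f : ℕ × ℕ} (h : ltF c d) (h' : ltF d f) : ltF c f := by
  unfold ltF at *; omega

theorem ltF_asymm {c d : ℕ × ℕ} (h : ltF c d) : ¬ ltF d c := by
  unfold ltF at *; omega

theorem ltF_total {c d : ℕ × ℕ} (h : c.1 ≠ d.1) : ltF c d ∨ ltF d c := by
  unfold ltF; omega

theorem not_ltF_iff {c d : ℕ × ℕ} (h : c.1 ≠ d.1) : ¬ ltF c d ↔ ltF d c :=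
  ⟨(ltF_total h).resolve_left, ltF_asymm⟩

/-! ### Major index under insertion of one letter or of an adjacent pair. -/

section Insertion

variable {R : Type*} [CommRing R]

/-- Inserting a new letter in all gaps multiplies the major index enumerator by a `q`-integer. -/
theorem sum_wordMaj_insertLetter (q : R) (c : ℕ × ℕ) (w : List (ℕ × ℕ))
    (hw : ∀ d ∈ w, c.1 ≠ d.1) :
    (1 - q) * ∑ i ∈ Finset.range (w.length + 1), q ^ wordMaj (insertLetter i c w) =
      q ^ wordMaj w * (1 - q ^ (w.length + 1)) := by
  induction w with
  | nil => simp [insertLetter, wordMaj]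
  | cons y u ih =>
    cases u with
    | nil =>
      have hy := not_ltF_iff (hw y (by simp))
      by_cases h : ltF c y
      · simp [Finset.sum_range_succ, insertLetter, wordMaj, h, ltF_asymm h]; ring
      · simp [Finset.sum_range_succ, insertLetter, wordMaj, h, hy.1 h]; ring
    | cons v u =>
      have ih := ih fun d hd => hw d (List.mem_cons_of_mem _ hd)
      simp only [List.length_cons] at ih ⊢
      -- The gaps on either side of `y` are split off. In the others the pair `y`, `v` stays
      -- adjacent and the induction hypothesis governs the tail.
      rw [Finset.sum_range_succ'] at ih ⊢
      rw [Finset.sum_range_succ']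
      simp only [insertLetter_succ_cons, insertLetter_zero, wordMaj_cons_cons,
        length_insertLetter, List.length_cons, pow_add] at ih ⊢
      rw [← Finset.sum_mul]
      have hy := not_ltF_iff (hw y (by simp))
      generalize (∑ i ∈ Finset.range (u.length + 1), q ^ wordMaj (v :: insertLetter i c u)) = T
        at ih ⊢
      generalize q ^ wordMaj (v :: u) = M at ih ⊢
      -- Transitivity excludes two of the eight order patterns. If `y`, `v` is a descent, a letter
      -- inserted in the tail shifts it by one place, whence the multiplier of `ih`.
      by_cases h1 : ltF y v <;> by_cases h2 : ltF c y <;> by_cases h3 : ltF c v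
      · simp [h1, h2, h3, ltF_asymm h2] at ih ⊢
        linear_combination q ^ (u.length + 1 + 1) * ih
      · exact absurd (ltF_trans h2 h1) h3
      · simp [h1, h2, h3, hy.1 h2] at ih ⊢
        linear_combination q ^ (u.length + 1 + 1) * ih
      · simp [h1, h2, h3, hy.1 h2] at ih ⊢
        linear_combination q ^ (u.length + 1 + 1) * ih
      · simp [h1, h2, h3, ltF_asymm h2] at ih ⊢
        linear_combination ih
      · simp [h1, h2, h3, ltF_asymm h2] at ih ⊢
        linear_combination ih
      · exact absurd (ltF_trans (hy.1 h2) h3) h1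
      · simp [h1, h2, h3, hy.1 h2] at ih ⊢
        linear_combination ih

/-- The alternating enumerator of the insertions of two adjacent letters in the same gap. -/
theorem sum_wordMaj_insertLetter_pair (q : R) (c c' : ℕ × ℕ) (w : List (ℕ × ℕ))
    (hw : ∀ d ∈ w, c.1 ≠ d.1) (hcc : ¬ ltF c' c)
    (hl : ∀ d ∈ w, (ltF d c' ↔ ltF d c)) :
    (1 - q ^ 2) * ∑ i ∈ Finset.range (w.length + 1), (1 - q ^ (w.length - i + 1)) *
        q ^ wordMaj (insertLetter i c' (insertLetter i c w)) =
      q ^ wordMaj w * ((1 - q ^ (w.length + 1)) * (1 - q ^ (w.length + 2))) := by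
  induction w with
  | nil => simp [insertLetter, wordMaj, hcc]; ring
  | cons y u ih =>
    cases u with
    | nil =>
      have hy := not_ltF_iff (hw y (by simp))
      have h1 := hl y (by simp)
      by_cases h : ltF c y
      · simp [Finset.sum_range_succ, insertLetter, wordMaj, h, ltF_asymm h, hcc, h1]; ring
      · simp [Finset.sum_range_succ, insertLetter, wordMaj, h, hy.1 h, hcc, h1]; ring
    | cons v u =>
      have ih := ih (fun d hd => hw d (List.mem_cons_of_mem _ hd))
        (fun d hd => hl d (List.mem_cons_of_mem _ hd))
      simp only [List.length_cons] at ih ⊢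
      rw [Finset.sum_range_succ'] at ih ⊢
      rw [Finset.sum_range_succ']
      simp only [insertLetter_succ_cons, insertLetter_zero, wordMaj_cons_cons,
        length_insertLetter, List.length_cons, pow_add, Nat.add_sub_add_right, Nat.sub_zero,
        ← mul_assoc, zero_add] at ih ⊢
      rw [← Finset.sum_mul]
      have hy := not_ltF_iff (hw y (by simp))
      -- `c'` always stands immediately before `c`, so the only other letter it meets is its left
      -- neighbour in the list; hence `hl` is one-sided.
      have h5 := hl y (by simp)
      generalize (∑ i ∈ Finset.range (u.length + 1), (_ : R)) = T at ih ⊢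
      generalize q ^ wordMaj (v :: u) = M at ih ⊢
      by_cases h1 : ltF y v <;> by_cases h2 : ltF c y <;> by_cases h3 : ltF c v
      · simp [h1, h2, h3, ltF_asymm h2, hcc, h5] at ih ⊢
        linear_combination q ^ (u.length + 1 + 1 + 1) * ih
      · exact absurd (ltF_trans h2 h1) h3
      · simp [h1, h2, h3, hy.1 h2, hcc, h5] at ih ⊢
        linear_combination q ^ (u.length + 1 + 1 + 1) * ih
      · simp [h1, h2, h3, hy.1 h2, hcc, h5] at ih ⊢
        linear_combination q ^ (u.length + 1 + 1 + 1) * ih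
      · simp [h1, h2, h3, ltF_asymm h2, hcc, h5] at ih ⊢
        linear_combination ih
      · simp [h1, h2, h3, ltF_asymm h2, hcc, h5] at ih ⊢
        linear_combination ih
      · exact absurd (ltF_trans (hy.1 h2) h3) h1
      · simp [h1, h2, h3, hy.1 h2, hcc, h5] at ih ⊢
        linear_combination ih

end Insertion

/-! ### Exchanging the values `a` and `a + 1`. -/

theorem wordMaj_map_of_isChain (g : ℕ × ℕ → ℕ × ℕ) (w : List (ℕ × ℕ))
    (h : w.IsChain fun c d => (ltF (g c) (g d) ↔ ltF c d)) : wordMaj (w.map g) = wordMaj w := by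
  induction w with
  | nil => rfl
  | cons c u ih =>
    cases u with
    | nil => rfl
    | cons d u =>
      rw [List.isChain_cons_cons] at h
      have := ih h.2
      simp only [List.map_cons, wordMaj_cons_cons, List.length_map, h.1] at this ⊢
      rw [this]

/-- Prepending letters changes the major index in a way that depends only on the order relation
with the next letter. -/
theorem wordMaj_append_cons_add (e : ℕ) (c c' : ℕ × ℕ) (s t t' : List (ℕ × ℕ))
    (hs : ∀ d ∈ s, (ltF d c ↔ ltF d c')) (ht : t.length = t'.length)
    (h : wordMaj (c :: t) = wordMaj (c' :: t') + e) :
    wordMaj (s ++ c :: t) = wordMaj (s ++ c' :: t') + e := by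
  induction s with
  | nil => exact h
  | cons d u ih =>
    have ih := ih fun f hf => hs f (List.mem_cons_of_mem _ hf)
    cases u with
    | nil =>
      simp only [List.cons_append, List.nil_append, wordMaj_cons_cons, ht, h, hs d (by simp)]
      omega
    | cons f u =>
      simp only [List.cons_append, wordMaj_cons_cons, List.length_append, List.length_cons,
        ht] at ih ⊢
      omega

theorem wordMaj_cons_congr (c c' : ℕ × ℕ) (t : List (ℕ × ℕ))
    (ht : ∀ d ∈ t, (ltF c d ↔ ltF c' d)) : wordMaj (c :: t) = wordMaj (c' :: t) := by
  cases t with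
  | nil => rfl
  | cons d u => simp only [wordMaj_cons_cons, ht d (by simp)]

theorem ltF_val_succ_right {a z : ℕ} {d : ℕ × ℕ} (h : d.1 ≠ a) :
    ltF d (a + 1, z) ↔ ltF d (a, z) := by
  simp only [ltF]; omega

theorem ltF_val_succ_left {a z : ℕ} {d : ℕ × ℕ} (h : d.1 ≠ a + 1) :
    ltF (a + 1, z) d ↔ ltF (a, z) d := by
  simp only [ltF]; omega

theorem wordMaj_swap_adjacent (a z : ℕ) (s t : List (ℕ × ℕ))
    (h : ∀ d ∈ s ++ t, d.1 ≠ a ∧ d.1 ≠ a + 1) :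
    wordMaj (s ++ (a, z) :: (a + 1, z) :: t) =
      wordMaj (s ++ (a + 1, z) :: (a, z) :: t) + (t.length + 1) := by
  simp only [List.mem_append] at h
  apply wordMaj_append_cons_add
  · intro d hd
    exact (ltF_val_succ_right (h d (.inl hd)).1).symm
  · rfl
  · rw [wordMaj_cons_cons, wordMaj_cons_cons, wordMaj_cons_congr (a + 1, z) (a, z)]
    · simp [ltF]
    · intro d hd
      exact ltF_val_succ_left (h d (.inr hd)).2

/-- No other value lies between `a` and `a + 1`, so the exchange can alter only the comparison of
these two letters. They are not compared if something separates them, and unequal colors decide the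
comparison without the values. -/
theorem wordMaj_swap_of_ne (a y z : ℕ) (s m t : List (ℕ × ℕ))
    (h : ∀ d ∈ s ++ m ++ t, d.1 ≠ a ∧ d.1 ≠ a + 1) (hne : m ≠ [] ∨ y ≠ z) :
    wordMaj (s ++ (a + 1, y) :: (m ++ (a, z) :: t)) =
      wordMaj (s ++ (a, y) :: (m ++ (a + 1, z) :: t)) := by
  set g : ℕ × ℕ → ℕ × ℕ := fun c => (Equiv.swap a (a + 1) c.1, c.2) with hg
  -- The alternative `c = d` is needed because below the pairs are known only by membership, which
  -- does not rule out coincidence.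
  have key : ∀ c d : ℕ × ℕ, (c.1 ≠ a ∧ c.1 ≠ a + 1) ∨ (d.1 ≠ a ∧ d.1 ≠ a + 1) ∨ c.2 ≠ d.2 ∨ c = d →
      (ltF (g c) (g d) ↔ ltF c d) := by
    intro c d hcd
    rcases c with ⟨c, u⟩
    rcases d with ⟨d, v⟩
    simp only [hg, ltF, Equiv.swap_apply_def, Prod.mk.injEq] at hcd ⊢
    split_ifs <;> omega
  have fix : ∀ w : List (ℕ × ℕ), (∀ d ∈ w, d.1 ≠ a ∧ d.1 ≠ a + 1) → w.map g = w := by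
    intro w hw
    refine (List.map_congr_left fun d hd => ?_).trans (List.map_id w)
    simp only [hg, id, Equiv.swap_apply_of_ne_of_ne (hw d hd).1 (hw d hd).2]
  simp only [List.mem_append] at h
  have hmap : s ++ (a + 1, y) :: (m ++ (a, z) :: t) =
      (s ++ (a, y) :: (m ++ (a + 1, z) :: t)).map g := by
    simp only [List.map_append, List.map_cons]
    rw [fix s fun d hd => h d (by tauto), fix m fun d hd => h d (by tauto),
      fix t fun d hd => h d (by tauto)]
    simp [hg]
  rw [hmap]
  apply wordMaj_map_of_isChain
  rcases m with _ | ⟨f, m⟩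
  · have hyz : y ≠ z := by simpa using hne
    apply List.Pairwise.isChain
    apply List.Pairwise.imp_of_mem (R := fun _ _ => True) _ (by simp [List.pairwise_iff_getElem])
    intro c d hc hd _
    apply key
    simp only [List.mem_append, List.mem_cons, List.nil_append] at hc hd
    rcases hc with hc | rfl | rfl | hc <;> rcases hd with hd | rfl | rfl | hd <;>
      first | exact .inl (h c (by tauto)) | exact .inr (.inl (h d (by tauto))) | simp [hyz, hyz.symm]
  · rw [List.cons_append, List.isChain_append_cons_cons]
    refine ⟨?_, key _ _ (.inr (.inl (h f (by simp)))), ?_⟩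
    · apply List.Pairwise.isChain
      apply List.Pairwise.imp_of_mem (R := fun _ _ => True) _ (by simp [List.pairwise_iff_getElem])
      intro c d hc hd _
      apply key
      simp only [List.mem_append, List.mem_singleton] at hc hd
      rcases hc with hc | rfl <;> rcases hd with hd | rfl <;>
        first | exact .inl (h c (by tauto)) | exact .inr (.inl (h d (by tauto))) | simp
    · apply List.Pairwise.isChain
      apply List.Pairwise.imp_of_mem (R := fun _ _ => True) _ (by simp [List.pairwise_iff_getElem])
      intro c d hc hd _
      apply key
      simp only [List.mem_append, List.mem_cons] at hc hd h
      rcases hc with hc | hc | rfl | hc <;> rcases hd with hd | hd | rfl | hd <;>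
        first | exact .inl (h c (by tauto)) | exact .inr (.inl (h d (by tauto))) | simp

theorem wordInv_insert (c : ℕ × ℕ) (s t : List (ℕ × ℕ)) :
    wordInv (s ++ c :: t) = wordInv (s ++ t) + s.countP (fun d => d.1 < c.1) +
      t.countP (fun d => c.1 < d.1) := by
  induction s with
  | nil => simp [wordInv]; omega
  | cons d s ih =>
    simp only [List.cons_append, wordInv, ih, List.countP_append, List.countP_cons]
    omega

theorem countP_lt_add_countP_gt (a : ℕ) (t : List (ℕ × ℕ)) (h : ∀ d ∈ t, a ≠ d.1) :
    t.countP (fun d => a < d.1) + t.countP (fun d => d.1 < a) = t.length := by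
  induction t with
  | nil => rfl
  | cons d t ih =>
    have := ih fun f hf => h f (List.mem_cons_of_mem _ hf)
    have hd := h d (by simp)
    simp only [List.countP_cons, List.length_cons, decide_eq_true_eq]
    split_ifs <;> omega

/-- Modulo 2, the larger letters of `t` may be traded for the smaller ones plus `t.length`. The sign
then depends only on the rank of the new value and on its position. -/
theorem neg_one_pow_wordInv_insert {R : Type*} [CommRing R] (c : ℕ × ℕ) (s t : List (ℕ × ℕ))
    (h : ∀ d ∈ t, c.1 ≠ d.1) :
    (-1 : R) ^ wordInv (s ++ c :: t) = (-1) ^ wordInv (s ++ t) *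
      (-1) ^ (s ++ t).countP (fun d => d.1 < c.1) * (-1) ^ t.length := by
  have := countP_lt_add_countP_gt c.1 t h
  rw [wordInv_insert, ← pow_add, ← pow_add, List.countP_append, ← this]
  set p := t.countP fun d => d.1 < c.1
  rw [neg_one_pow_congr]
  simp only [Nat.even_add]
  tauto

theorem neg_one_pow_wordInv_swap {R : Type*} [CommRing R] (a y z : ℕ) (s m t : List (ℕ × ℕ))
    (h : ∀ d ∈ s ++ m ++ t, d.1 ≠ a ∧ d.1 ≠ a + 1) :
    (-1 : R) ^ wordInv (s ++ (a, y) :: (m ++ (a + 1, z) :: t)) =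
        (-1) ^ wordInv (s ++ m ++ t) * (-1) ^ (m.length + 1) ∧
      (-1 : R) ^ wordInv (s ++ (a + 1, y) :: (m ++ (a, z) :: t)) =
        (-1) ^ wordInv (s ++ m ++ t) * (-1) ^ m.length := by
  have hcount : (s ++ m ++ t).countP (fun d => d.1 < a + 1) =
      (s ++ m ++ t).countP (fun d => d.1 < a) := by
    apply List.countP_congr
    intro d hd
    have := h d hd
    simp only [decide_eq_true_eq]; omega
  simp only [List.mem_append] at h
  constructor
  · rw [neg_one_pow_wordInv_insert, ← List.append_assoc, neg_one_pow_wordInv_insert]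
    · have : (s ++ m ++ (a + 1, z) :: t).countP (fun d => d.1 < a) =
          (s ++ m ++ t).countP (fun d => d.1 < a) := by
        simp [List.countP_append]
      rw [this, hcount]
      simp only [← pow_add]
      apply neg_one_pow_congr
      simp only [List.length_append, List.length_cons, Nat.even_add]
      tauto
    · intro d hd; exact ((h d (by tauto)).2).symm
    · intro d hd
      simp only [List.mem_append, List.mem_cons] at hd
      rcases hd with hd | rfl | hd
      · exact ((h d (by tauto)).1).symm
      · simp
      · exact ((h d (by tauto)).1).symm
  · rw [neg_one_pow_wordInv_insert, ← List.append_assoc, neg_one_pow_wordInv_insert]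
    · have : (s ++ m ++ (a, z) :: t).countP (fun d => d.1 < a + 1) =
          (s ++ m ++ t).countP (fun d => d.1 < a) + 1 := by
        rw [← hcount]
        simp [List.countP_append]; omega
      rw [this]
      simp only [← pow_add]
      apply neg_one_pow_congr
      simp only [List.length_append, List.length_cons, Nat.even_add]
      tauto
    · intro d hd; exact ((h d (by tauto)).1).symm
    · intro d hd
      simp only [List.mem_append, List.mem_cons] at hd
      rcases hd with hd | rfl | hd
      · exact ((h d (by tauto)).2).symm
      · simp
      · exact ((h d (by tauto)).2).symm

/-! ### Bookkeeping for two successive insertions. -/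

theorem insertLetter_insertLetter_of_le {p i : ℕ} (h : p ≤ i) (c d : ℕ × ℕ) (w : List (ℕ × ℕ))
    (hi : i ≤ w.length) :
    insertLetter (i + 1) d (insertLetter p c w) = insertLetter p c (insertLetter i d w) := by
  induction w generalizing p i with
  | nil =>
    obtain rfl : i = 0 := by simpa using hi
    obtain rfl : p = 0 := by omega
    rfl
  | cons f w ih =>
    cases p with
    | zero => rfl
    | succ p =>
      obtain ⟨i, rfl⟩ : ∃ j, i = j + 1 := ⟨i - 1, by omega⟩
      simp only [insertLetter_succ_cons, List.cons.injEq, true_and]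
      exact ih (by omega) (by simpa using hi)

theorem exists_insertLetter_insertLetter {p i : ℕ} (h : p ≤ i) (w : List (ℕ × ℕ))
    (hi : i ≤ w.length) : ∃ s m t : List (ℕ × ℕ), w = s ++ m ++ t ∧ m.length = i - p ∧
      s.length = p ∧
      ∀ c d, insertLetter p c (insertLetter i d w) = s ++ c :: (m ++ d :: t) := by
  obtain ⟨u, t, rfl, hu⟩ : ∃ u t, w = u ++ t ∧ u.length = i :=
    ⟨w.take i, w.drop i, by simp, by simpa using hi⟩
  obtain ⟨s, m, rfl, hs⟩ : ∃ s m, u = s ++ m ∧ s.length = p :=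
    ⟨u.take p, u.drop p, by simp, by simp; omega⟩
  subst hu hs
  refine ⟨s, m, t, rfl, by simp, rfl, fun c d => ?_⟩
  have h1 : insertLetter (s ++ m).length d (s ++ m ++ t) = s ++ (m ++ d :: t) := by
    simp only [insertLetter, List.take_left, List.drop_left]
    simp only [List.append_assoc]
  rw [h1]
  simp only [insertLetter, List.take_left, List.drop_left]

/-- Gaps `(i, p)` and `(p, i + 1)` with `p ≤ i` place the two letters in the same two positions with
their roles exchanged. This is the pairing behind the sign cancellation. -/
theorem sum_range_sum_range_succ {M : Type*} [AddCommMonoid M] (l : ℕ) (F : ℕ → ℕ → M) :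
    ∑ i ∈ Finset.range l, ∑ j ∈ Finset.range (l + 1), F i j =
      ∑ i ∈ Finset.range l, ∑ p ∈ Finset.range (i + 1), (F i p + F p (i + 1)) := by
  have h1 : ∀ i ∈ Finset.range l, ∑ j ∈ Finset.range (l + 1), F i j =
      ∑ p ∈ Finset.range (i + 1), F i p + ∑ j ∈ Finset.Ico i l, F i (j + 1) := by
    intro i hi
    rw [Finset.mem_range] at hi
    rw [Finset.sum_Ico_add' (fun j => F i j) i l 1,
      Finset.sum_range_add_sum_Ico _ (by omega)]
  rw [Finset.sum_congr rfl h1, Finset.sum_add_distrib]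
  simp only [Finset.sum_add_distrib]
  congr 1
  rw [Finset.range_eq_Ico, Finset.sum_Ico_Ico_comm]
  simp

/-! ### Weighted sums over one insertion and over an adjacent pair. -/

section Weight

variable {R : Type*} [CommRing R]

/-- Gaps contribute `[l+1]_{x^r}` and colors `[r]_x`; their product is `[(l+1)r]_x`. -/
theorem sum_wordWeight_insertLetter [IsDomain R] (r a : ℕ) (x : R) (w : List (ℕ × ℕ)) (hw : ∀ d ∈ w, a ≠ d.1)
    (hx : x ^ r ≠ 1) :
    ∑ i ∈ Finset.range (w.length + 1), ∑ z ∈ Finset.range r,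
        wordWeight r 1 x (insertLetter i (a, z) w) =
      wordWeight r 1 x w * ∑ j ∈ Finset.range ((w.length + 1) * r), x ^ j := by
  have key := fun z => sum_wordMaj_insertLetter (x ^ r) (a, z) w hw
  have h1 : ∀ i z, wordWeight r 1 x (insertLetter i (a, z) w) =
      (x ^ r) ^ wordMaj (insertLetter i (a, z) w) * (x ^ wordCol w * x ^ z) := by
    intro i z
    simp only [wordWeight, wordCol_insertLetter, one_pow, one_mul, pow_add, pow_mul]
  rw [Finset.sum_comm]
  simp only [h1, ← Finset.sum_mul]
  have hx' : 1 - x ≠ 0 := fun h => hx (by rw [← sub_eq_zero.1 h, one_pow])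
  apply mul_left_cancel₀ (mul_ne_zero hx' (sub_ne_zero.2 hx.symm))
  rw [Finset.mul_sum]
  have h2 : ∀ z, (1 - x) * (1 - x ^ r) * ((∑ i ∈ Finset.range (w.length + 1),
      (x ^ r) ^ wordMaj (insertLetter i (a, z) w)) * (x ^ wordCol w * x ^ z)) =
      (1 - x) * ((x ^ r) ^ wordMaj w * (1 - (x ^ r) ^ (w.length + 1)) * x ^ wordCol w) * x ^ z := by
    intro z
    rw [← key z]; ring
  rw [Finset.sum_congr rfl fun z _ => h2 z, ← Finset.mul_sum]
  have h3 := mul_neg_geom_sum x r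
  have h4 := mul_neg_geom_sum x ((w.length + 1) * r)
  have h5 : wordWeight r 1 x w = (x ^ r) ^ wordMaj w * x ^ wordCol w := by
    simp only [wordWeight, one_pow, one_mul, pow_add, pow_mul]
  have h6 : x ^ ((w.length + 1) * r) = (x ^ r) ^ (w.length + 1) := by rw [← pow_mul, mul_comm]
  rw [h6] at h4
  rw [h5]
  linear_combination ((x ^ r) ^ wordMaj w * (1 - (x ^ r) ^ (w.length + 1)) * x ^ wordCol w) * h3 -
    (1 - x ^ r) * ((x ^ r) ^ wordMaj w * x ^ wordCol w) * h4

theorem wordWeight_swap (r a y z : ℕ) (x : R) (s m t : List (ℕ × ℕ))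
    (h : ∀ d ∈ s ++ m ++ t, d.1 ≠ a ∧ d.1 ≠ a + 1) (hne : m ≠ [] ∨ y ≠ z) :
    wordWeight r (-1) x (s ++ (a + 1, y) :: (m ++ (a, z) :: t)) +
      wordWeight r (-1) x (s ++ (a, y) :: (m ++ (a + 1, z) :: t)) = 0 := by
  obtain ⟨h1, h2⟩ := neg_one_pow_wordInv_swap (R := R) a y z s m t h
  have h3 : wordCol (s ++ (a + 1, y) :: (m ++ (a, z) :: t)) =
      wordCol (s ++ (a, y) :: (m ++ (a + 1, z) :: t)) := by
    simp [wordCol]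
  rw [wordWeight, wordWeight, h1, h2, h3, wordMaj_swap_of_ne a y z s m t h hne]
  ring

theorem wordWeight_swap_adjacent (r a z : ℕ) (x : R) (s t : List (ℕ × ℕ))
    (h : ∀ d ∈ s ++ t, d.1 ≠ a ∧ d.1 ≠ a + 1) :
    wordWeight r (-1) x (s ++ (a + 1, z) :: (a, z) :: t) +
        wordWeight r (-1) x (s ++ (a, z) :: (a + 1, z) :: t) =
      (-1) ^ wordInv (s ++ t) * x ^ wordCol (s ++ t) * x ^ (2 * z) *
        ((1 - (x ^ r) ^ (t.length + 1)) *
          (x ^ r) ^ wordMaj (s ++ (a + 1, z) :: (a, z) :: t)) := by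
  obtain ⟨h1, h2⟩ := neg_one_pow_wordInv_swap (R := R) a z z s [] t (by simpa using h)
  simp only [List.nil_append, List.append_nil, List.length_nil] at h1 h2
  have h3 : wordCol (s ++ (a + 1, z) :: (a, z) :: t) = wordCol (s ++ t) + 2 * z := by
    simp [wordCol]; ring
  have h4 : wordCol (s ++ (a, z) :: (a + 1, z) :: t) = wordCol (s ++ t) + 2 * z := by
    simp [wordCol]; ring
  rw [wordWeight, wordWeight, h1, h2, h3, h4, wordMaj_swap_adjacent a z s t h]
  ring

/-- After cancellation both letters share a gap and a color `z`. The colors sum to `[r]_{x^2}`, and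
the gaps are summed by `sum_wordMaj_insertLetter_pair` at `q = x^r`. -/
theorem sum_wordWeight_insertLetter_pair [IsDomain R] (r a : ℕ) (x : R) (w : List (ℕ × ℕ))
    (hw : ∀ d ∈ w, d.1 ≠ a ∧ d.1 ≠ a + 1) (hx : (x ^ 2) ^ r ≠ 1) :
    ∑ i ∈ Finset.range (w.length + 1), ∑ y ∈ Finset.range r,
        ∑ j ∈ Finset.range (w.length + 2), ∑ z ∈ Finset.range r,
          wordWeight r (-1) x (insertLetter j (a + 1, z) (insertLetter i (a, y) w)) =
      wordWeight r (-1) x w *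
        ((∑ j ∈ Finset.range ((w.length + 1) * r), ((-1) ^ w.length * x) ^ j) *
          ∑ j ∈ Finset.range ((w.length + 2) * r), ((-1) ^ (w.length + 1) * x) ^ j) := by
  have hS : ∑ i ∈ Finset.range (w.length + 1), ∑ y ∈ Finset.range r,
        ∑ j ∈ Finset.range (w.length + 2), ∑ z ∈ Finset.range r,
          wordWeight r (-1) x (insertLetter j (a + 1, z) (insertLetter i (a, y) w)) =
      ∑ i ∈ Finset.range (w.length + 1), ∑ z ∈ Finset.range r,
        (wordWeight r (-1) x (insertLetter i (a + 1, z) (insertLetter i (a, z) w)) +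
          wordWeight r (-1) x (insertLetter i (a, z) (insertLetter i (a + 1, z) w))) := by
    have h1 : ∀ i, ∑ y ∈ Finset.range r,
        ∑ j ∈ Finset.range (w.length + 2), ∑ z ∈ Finset.range r,
          wordWeight r (-1) x (insertLetter j (a + 1, z) (insertLetter i (a, y) w)) =
        ∑ j ∈ Finset.range (w.length + 1 + 1), ∑ y ∈ Finset.range r, ∑ z ∈ Finset.range r,
          wordWeight r (-1) x (insertLetter j (a + 1, z) (insertLetter i (a, y) w)) :=
      fun i => Finset.sum_comm
    rw [Finset.sum_congr rfl fun i _ => h1 i, sum_range_sum_range_succ]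
    refine Finset.sum_congr rfl fun i hi => ?_
    rw [Finset.mem_range] at hi
    have h2 : ∀ p ∈ Finset.range (i + 1),
        (∑ y ∈ Finset.range r, ∑ z ∈ Finset.range r,
            wordWeight r (-1) x (insertLetter p (a + 1, z) (insertLetter i (a, y) w)) +
          ∑ y ∈ Finset.range r, ∑ z ∈ Finset.range r,
            wordWeight r (-1) x (insertLetter (i + 1) (a + 1, z) (insertLetter p (a, y) w))) =
        ∑ z ∈ Finset.range r, ∑ y ∈ Finset.range r,
          (wordWeight r (-1) x (insertLetter p (a + 1, z) (insertLetter i (a, y) w)) +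
            wordWeight r (-1) x (insertLetter p (a, z) (insertLetter i (a + 1, y) w))) := by
      intro p hp
      rw [Finset.mem_range] at hp
      simp only [Finset.sum_add_distrib]
      congr 1
      · exact Finset.sum_comm
      · refine Finset.sum_congr rfl fun y _ => Finset.sum_congr rfl fun z _ => ?_
        rw [insertLetter_insertLetter_of_le (by omega) _ _ _ (by omega)]
    -- Only `p = i` (no letter between the two) and then `y = z` survive the cancellation.
    rw [Finset.sum_congr rfl h2, Finset.sum_eq_single_of_mem i (by simp)]
    · refine Finset.sum_congr rfl fun z hz => ?_
      rw [Finset.sum_eq_single_of_mem z hz]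
      intro y _ hy
      obtain ⟨s, m, t, rfl, -, -, h⟩ := exists_insertLetter_insertLetter le_rfl w (i := i) (by omega)
      rw [h, h]
      exact wordWeight_swap r a z y x s m t hw (.inr hy.symm)
    · intro p hp hne
      rw [Finset.mem_range] at hp
      refine Finset.sum_eq_zero fun z _ => Finset.sum_eq_zero fun y _ => ?_
      obtain ⟨s, m, t, rfl, hm, -, h⟩ :=
        exists_insertLetter_insertLetter (p := p) (i := i) (by omega) w (by omega)
      rw [h, h]
      refine wordWeight_swap r a z y x s m t hw (.inl ?_)
      rw [← List.length_pos_iff]; omega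
  have hT : ∀ i ∈ Finset.range (w.length + 1), ∀ z,
      (wordWeight r (-1) x (insertLetter i (a + 1, z) (insertLetter i (a, z) w)) +
          wordWeight r (-1) x (insertLetter i (a, z) (insertLetter i (a + 1, z) w))) =
      (-1) ^ wordInv w * x ^ wordCol w * x ^ (2 * z) *
        ((1 - (x ^ r) ^ (w.length - i + 1)) *
          (x ^ r) ^ wordMaj (insertLetter i (a + 1, z) (insertLetter i (a, z) w))) := by
    intro i hi z
    rw [Finset.mem_range] at hi
    obtain ⟨s, m, t, rfl, hm, hs, h⟩ := exists_insertLetter_insertLetter le_rfl w (i := i) (by omega)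
    obtain rfl : m = [] := by simpa using hm
    subst hs
    simp only [List.append_nil, List.nil_append] at *
    rw [h, h, wordWeight_swap_adjacent r a z x s t hw]
    simp
  rw [hS, Finset.sum_congr rfl fun i hi => Finset.sum_congr rfl fun z _ => hT i hi z,
    Finset.sum_comm]
  simp only [← Finset.mul_sum]
  have key := fun z => sum_wordMaj_insertLetter_pair (x ^ r) (a, z) (a + 1, z) w
    (fun d hd => (hw d hd).1.symm) (by simp [ltF])
    (fun d hd => ltF_val_succ_right (hw d hd).1)
  have hx' : 1 - x ^ 2 ≠ 0 := fun h => hx (by rw [← sub_eq_zero.1 h, one_pow])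
  apply mul_left_cancel₀ (mul_ne_zero hx' (sub_ne_zero.2 hx.symm))
  rw [Finset.mul_sum]
  have h2 : ∀ z, (1 - x ^ 2) * (1 - (x ^ 2) ^ r) * ((-1) ^ wordInv w * x ^ wordCol w * x ^ (2 * z) *
      ∑ i ∈ Finset.range (w.length + 1), (1 - (x ^ r) ^ (w.length - i + 1)) *
        (x ^ r) ^ wordMaj (insertLetter i (a + 1, z) (insertLetter i (a, z) w))) =
      (1 - x ^ 2) * ((-1) ^ wordInv w * x ^ wordCol w * ((x ^ r) ^ wordMaj w *
        ((1 - (x ^ r) ^ (w.length + 1)) * (1 - (x ^ r) ^ (w.length + 2))))) * (x ^ 2) ^ z := by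
    intro z
    rw [← key z]; ring
  rw [Finset.sum_congr rfl fun z _ => h2 z, ← Finset.mul_sum]
  have h3 := mul_neg_geom_sum (x ^ 2) r
  have h4 := mul_neg_geom_sum ((-1) ^ w.length * x) ((w.length + 1) * r)
  have h5 := mul_neg_geom_sum ((-1) ^ (w.length + 1) * x) ((w.length + 2) * r)
  have h6 : wordWeight r (-1) x w = (-1) ^ wordInv w * ((x ^ r) ^ wordMaj w * x ^ wordCol w) := by
    simp only [wordWeight, pow_add, pow_mul]
  -- The sign disappears because `l (l + 1)` is even.
  have h7 : ((-1) ^ w.length * x) ^ ((w.length + 1) * r) = (x ^ r) ^ (w.length + 1) := by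
    rw [mul_pow, ← pow_mul, ← mul_assoc, (Nat.even_mul_succ_self w.length).mul_right r |>.neg_one_pow,
      one_mul, ← pow_mul, mul_comm]
  have h8 : ((-1) ^ (w.length + 1) * x) ^ ((w.length + 2) * r) = (x ^ r) ^ (w.length + 2) := by
    rw [mul_pow, ← pow_mul, ← mul_assoc,
      (Nat.even_mul_succ_self (w.length + 1)).mul_right r |>.neg_one_pow,
      one_mul, ← pow_mul, mul_comm]
  -- The two signs are opposite, so the denominators of the two signed `q`-integers multiply to `1 -
  -- x^2`.
  have h9 : (1 - (-1) ^ w.length * x) * (1 - (-1) ^ (w.length + 1) * x) = 1 - x ^ 2 := by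
    rcases neg_one_pow_eq_or R w.length with h | h <;> rw [pow_succ, h] <;> ring
  rw [h7] at h4
  rw [h8] at h5
  rw [h6, ← h4, ← h5, ← h9]
  rw [← h9] at h3
  linear_combination ((-1) ^ wordInv w * x ^ wordCol w * ((x ^ r) ^ wordMaj w *
    (((1 - (-1) ^ w.length * x) * ∑ j ∈ Finset.range ((w.length + 1) * r), ((-1) ^ w.length * x) ^ j) *
      ((1 - (-1) ^ (w.length + 1) * x) *
        ∑ j ∈ Finset.range ((w.length + 2) * r), ((-1) ^ (w.length + 1) * x) ^ j)))) * h3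

end Weight

/-! ### The set of words generated by insertions. -/

/-- The colored words obtained from `w₀` by inserting the letters of `L` one after the other,
starting from the end of `L`, with arbitrary colors in `{0, …, r - 1}`. -/
def extensions (r : ℕ) (w₀ : List (ℕ × ℕ)) : List ℕ → Finset (List (ℕ × ℕ))
  | [] => {w₀}
  | a :: L => (extensions r w₀ L).biUnion fun w =>
      (Finset.range (w.length + 1) ×ˢ Finset.range r).image fun p => insertLetter p.1 (a, p.2) w

theorem mem_extensions_cons {r : ℕ} {w₀ w : List (ℕ × ℕ)} {a : ℕ} {L : List ℕ} :
    w ∈ extensions r w₀ (a :: L) ↔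
      ∃ u ∈ extensions r w₀ L, ∃ i z, i ≤ u.length ∧ z < r ∧ insertLetter i (a, z) u = w := by
  simp [extensions, and_assoc]

theorem insertLetter_perm (i : ℕ) (c : ℕ × ℕ) (w) : (insertLetter i c w).Perm (c :: w) := by
  conv_rhs => rw [← List.take_append_drop i w]
  exact List.perm_middle

theorem sublist_insertLetter (i : ℕ) (c : ℕ × ℕ) (w : List (ℕ × ℕ)) : w.Sublist (insertLetter i c w) := by
  conv_lhs => rw [← List.take_append_drop i w]
  exact (List.Sublist.refl _).append (List.sublist_cons_self _ _)

/-- The value `a` is new, so the part of the word before it recovers the gap. Hence the sums over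
insertions count no word twice. -/
theorem insertLetter_injective {i j a y z : ℕ} {u w : List (ℕ × ℕ)} (hi : i ≤ u.length)
    (hj : j ≤ w.length) (hu : a ∉ u.map Prod.fst) (hw : a ∉ w.map Prod.fst)
    (h : insertLetter i (a, y) u = insertLetter j (a, z) w) : i = j ∧ y = z ∧ u = w := by
  have key : ∀ (k v : ℕ) (x : List (ℕ × ℕ)), a ∉ x.map Prod.fst →
      (insertLetter k (a, v) x).takeWhile (fun c => decide (c.1 ≠ a)) = x.take k := by
    intro k v x hx
    rw [insertLetter, List.takeWhile_append_of_pos]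
    · simp
    · intro c hc
      simp only [decide_eq_true_eq]
      rintro rfl
      exact hx (List.mem_map_of_mem (List.mem_of_mem_take hc))
  have h1 : u.take i = w.take j := by rw [← key i y u hu, ← key j z w hw, h]
  have h2 : i = j := by
    have := congrArg List.length h1
    simpa [hi, hj] using this
  rw [insertLetter, insertLetter, h1] at h
  have h3 := List.append_cancel_left h
  simp only [List.cons.injEq, Prod.mk.injEq, true_and] at h3
  refine ⟨h2, h3.1, ?_⟩
  rw [← List.take_append_drop i u, ← List.take_append_drop j w, h1, h3.2]

theorem perm_of_mem_extensions {r : ℕ} {w₀ w : List (ℕ × ℕ)} {L : List ℕ}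
    (hw : w ∈ extensions r w₀ L) : (w.map Prod.fst).Perm (L ++ w₀.map Prod.fst) := by
  induction L generalizing w with
  | nil => simp only [extensions, Finset.mem_singleton] at hw; simp [hw]
  | cons a L ih =>
    obtain ⟨u, hu, i, z, -, -, rfl⟩ := mem_extensions_cons.1 hw
    exact ((insertLetter_perm i (a, z) u).map Prod.fst).trans ((ih hu).cons a)

theorem length_of_mem_extensions {r : ℕ} {w₀ w : List (ℕ × ℕ)} {L : List ℕ}
    (hw : w ∈ extensions r w₀ L) : w.length = L.length + w₀.length := by
  simpa using (perm_of_mem_extensions hw).length_eq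

theorem mem_extensions_iff {r : ℕ} {w₀ w : List (ℕ × ℕ)} {L : List ℕ}
    (hL : (L ++ w₀.map Prod.fst).Nodup) (hr : ∀ c ∈ w₀, c.2 < r) :
    w ∈ extensions r w₀ L ↔ w₀.Sublist w ∧ (w.map Prod.fst).Perm (L ++ w₀.map Prod.fst) ∧
      ∀ c ∈ w, c.2 < r := by
  induction L generalizing w with
  | nil =>
    simp only [extensions, Finset.mem_singleton, List.nil_append]
    constructor
    · rintro rfl
      exact ⟨List.Sublist.refl _, List.Perm.refl _, hr⟩
    · rintro ⟨h1, h2, -⟩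
      exact (h1.eq_of_length (by simpa using h2.length_eq.symm)).symm
  | cons a L ih =>
    rw [List.cons_append, List.nodup_cons] at hL
    rw [mem_extensions_cons]
    constructor
    · rintro ⟨u, hu, i, z, -, hz, rfl⟩
      obtain ⟨h1, h2, h3⟩ := (ih hL.2).1 hu
      refine ⟨h1.trans (sublist_insertLetter _ _ _),
        ((insertLetter_perm i (a, z) u).map Prod.fst).trans (h2.cons a), ?_⟩
      intro c hc
      rcases mem_insertLetter.1 hc with rfl | hc
      exacts [hz, h3 c hc]
    · rintro ⟨h1, h2, h3⟩
      obtain ⟨⟨a', z⟩, hc, rfl⟩ := List.mem_map.1 (h2.mem_iff.2 (List.mem_cons_self))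
      obtain ⟨s, t, rfl⟩ := List.append_of_mem hc
      refine ⟨s ++ t, (ih hL.2).2 ⟨?_, ?_, fun c hc => h3 c ?_⟩, s.length, z, by simp, h3 _ hc, ?_⟩
      · have hn : (a', z) ∉ w₀ := fun h =>
          hL.1 (List.mem_append_right _ (List.mem_map_of_mem (f := Prod.fst) h))
        have hs : (a', z) ∉ s := by
          have : ((s ++ (a', z) :: t).map Prod.fst).Nodup :=
            h2.nodup_iff.2 (List.nodup_cons.2 hL)
          intro h
          rw [List.map_append, List.nodup_append] at this
          exact this.2.2 a' (List.mem_map_of_mem (f := Prod.fst) h) a' (by simp) rfl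
        -- The erased letter is not in `w₀`, so `w₀` remains a sublist of what is left.
        have := h1.erase (a', z)
        rwa [List.erase_of_not_mem hn, List.erase_append_right _ hs, List.erase_cons_head] at this
      · apply List.Perm.cons_inv (a := a')
        refine List.Perm.trans ?_ h2
        exact (List.perm_middle.symm : ((a', z) :: (s ++ t)).Perm _).map Prod.fst
      · simp only [List.mem_append, List.mem_cons] at hc ⊢; tauto
      · simp [insertLetter]

theorem sum_extensions_cons {M : Type*} [AddCommMonoid M] {r a : ℕ} {w₀ : List (ℕ × ℕ)} {L : List ℕ}
    (ha : a ∉ L ++ w₀.map Prod.fst) (f : List (ℕ × ℕ) → M) :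
    ∑ w ∈ extensions r w₀ (a :: L), f w = ∑ w ∈ extensions r w₀ L,
      ∑ i ∈ Finset.range (w.length + 1), ∑ z ∈ Finset.range r, f (insertLetter i (a, z) w) := by
  have hmem : ∀ w ∈ extensions r w₀ L, a ∉ w.map Prod.fst := fun w hw h =>
    ha ((perm_of_mem_extensions hw).mem_iff.1 h)
  rw [extensions, Finset.sum_biUnion]
  · refine Finset.sum_congr rfl fun w hw => ?_
    rw [Finset.sum_image, Finset.sum_product]
    rintro ⟨i, y⟩ hi ⟨j, z⟩ hj h
    simp only [Finset.coe_product, Set.mem_prod, Finset.coe_range, Set.mem_Iio] at hi hj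
    obtain ⟨h1, h2, -⟩ := insertLetter_injective (by omega) (by omega) (hmem w hw) (hmem w hw) h
    exact Prod.ext h1 h2
  · intro u hu w hw hne
    rw [Function.onFun, Finset.disjoint_left]
    intro x hx hx'
    simp only [Finset.mem_image, Finset.mem_product, Finset.mem_range, Prod.exists] at hx hx'
    obtain ⟨i, y, ⟨hi, -⟩, rfl⟩ := hx
    obtain ⟨j, z, ⟨hj, -⟩, h⟩ := hx'
    exact hne (insertLetter_injective (by omega) (by omega) (hmem u hu) (hmem w hw) h.symm).2.2

/-! ### Factors contributed by pairs of adjacent values. -/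

section Weight

variable {R : Type*} [CommRing R] [IsDomain R]

/-- Inserting two letters of adjacent values multiplies the signed flag major index enumerator by
two signed `q`-integers. -/
theorem sum_wordWeight_extensions_pair {r a : ℕ} {e x : R} (he : e = 1 ∨ e = -1)
    (hx : (x ^ 2) ^ r ≠ 1) {w₀ : List (ℕ × ℕ)} {L : List ℕ}
    (ha : ((a + 1) :: a :: (L ++ w₀.map Prod.fst)).Nodup) :
    ∑ w ∈ extensions r w₀ ((a + 1) :: a :: L), wordWeight r e x w =
      (∑ w ∈ extensions r w₀ L, wordWeight r e x w) *
        ((∑ j ∈ Finset.range ((L.length + w₀.length + 1) * r),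
            (e ^ (L.length + w₀.length) * x) ^ j) *
          ∑ j ∈ Finset.range ((L.length + w₀.length + 2) * r),
            (e ^ (L.length + w₀.length + 1) * x) ^ j) := by
  have hx' : x ^ r ≠ 1 := fun h => hx (by rw [← pow_mul, mul_comm, pow_mul, h, one_pow])
  rw [List.nodup_cons, List.nodup_cons] at ha
  obtain ⟨ha1, ha0, -⟩ := ha
  have hfresh : ∀ w ∈ extensions r w₀ L, ∀ d ∈ w, d.1 ≠ a ∧ d.1 ≠ a + 1 := by
    intro w hw d hd
    have := (perm_of_mem_extensions hw).mem_iff.1 (List.mem_map_of_mem (f := Prod.fst) hd)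
    constructor
    · intro h; rw [h] at this; exact ha0 this
    · intro h; rw [h] at this; exact ha1 (List.mem_cons_of_mem _ this)
  rw [sum_extensions_cons ha1, sum_extensions_cons ha0, Finset.sum_mul]
  refine Finset.sum_congr rfl fun w hw => ?_
  have hlen := length_of_mem_extensions hw
  rw [← hlen]
  simp only [length_insertLetter]
  rcases he with rfl | rfl
  · have h1 : ∀ i, ∀ y, ∑ j ∈ Finset.range (w.length + 1 + 1), ∑ z ∈ Finset.range r,
        wordWeight r 1 x (insertLetter j (a + 1, z) (insertLetter i (a, y) w)) =
        wordWeight r 1 x (insertLetter i (a, y) w) *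
          ∑ j ∈ Finset.range ((w.length + 2) * r), x ^ j := by
      intro i y
      have := sum_wordWeight_insertLetter r (a + 1) x (insertLetter i (a, y) w) (by
        intro d hd
        rcases mem_insertLetter.1 hd with rfl | hd
        · simp
        · exact ((hfresh w hw d hd).2).symm) hx'
      simpa only [length_insertLetter] using this
    simp only [h1, ← Finset.sum_mul]
    rw [sum_wordWeight_insertLetter r a x w (fun d hd => ((hfresh w hw d hd).1).symm) hx']
    simp only [one_pow, one_mul, mul_assoc]
  · exact sum_wordWeight_insertLetter_pair r a x w (hfresh w hw) hx

theorem sum_wordWeight_extensions_pairs {r : ℕ} {e x : R} (he : e = 1 ∨ e = -1)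
    (hx : (x ^ 2) ^ r ≠ 1) {w₀ : List (ℕ × ℕ)} {L : List ℕ} (P : List ℕ)
    (hP : (P.flatMap (fun a => [a + 1, a]) ++ L ++ w₀.map Prod.fst).Nodup) :
    ∑ w ∈ extensions r w₀ (P.flatMap (fun a => [a + 1, a]) ++ L), wordWeight r e x w =
      (∑ w ∈ extensions r w₀ L, wordWeight r e x w) *
        ∏ i ∈ Finset.Icc (L.length + w₀.length + 1) (2 * P.length + L.length + w₀.length),
          ∑ j ∈ Finset.range (i * r), (e ^ (i - 1) * x) ^ j := by
  induction P with
  | nil => simp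
  | cons a P ih =>
    simp only [List.flatMap_cons, List.cons_append, List.nil_append] at hP ⊢
    rw [sum_wordWeight_extensions_pair he hx hP,
      ih ((List.nodup_cons.1 (List.nodup_cons.1 hP).2).2)]
    have hlen : (P.flatMap (fun a => [a + 1, a]) ++ L).length + w₀.length =
        2 * P.length + L.length + w₀.length := by
      simp [List.length_flatMap]; ring
    have hlen' : 2 * (a :: P).length + L.length + w₀.length =
        2 * P.length + L.length + w₀.length + 1 + 1 := by
      simp; ring
    rw [hlen, hlen', Finset.prod_Icc_succ_top (by omega), Finset.prod_Icc_succ_top (by omega)]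
    simp only [Nat.add_sub_cancel, mul_assoc]

end Weight

/-! ### The bare block and the leftover letter. -/

section Base

variable {R : Type*} [CommRing R]

theorem wordInv_of_pairwise {w : List (ℕ × ℕ)} (h : w.Pairwise fun c d => d.1 < c.1) :
    wordInv w = 0 := by
  induction w with
  | nil => rfl
  | cons c w ih =>
    rw [List.pairwise_cons] at h
    rw [wordInv, ih h.2, add_zero, List.countP_eq_zero]
    intro d hd
    have := h.1 d hd
    simp only [decide_eq_true_eq]; omega

theorem wordMaj_of_isChain {w : List (ℕ × ℕ)} (h : w.IsChain fun c d => ¬ ltF c d) :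
    wordMaj w = 0 := by
  induction w with
  | nil => rfl
  | cons c w ih =>
    cases w with
    | nil => rfl
    | cons d w =>
      rw [List.isChain_cons_cons] at h
      simp [wordMaj_cons_cons, h.1, ih h.2]

theorem wordWeight_of_pairwise (r : ℕ) (e x : R) {w : List (ℕ × ℕ)}
    (h : w.Pairwise fun c d => d.1 < c.1) (h0 : ∀ c ∈ w, c.2 = 0) : wordWeight r e x w = 1 := by
  have h1 : wordMaj w = 0 := by
    apply wordMaj_of_isChain
    apply List.Pairwise.isChain
    apply h.imp_of_mem
    intro c d hc hd hcd
    have := h0 c hc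
    have := h0 d hd
    simp only [ltF]; omega
  have h2 : wordCol w = 0 := by
    rw [wordCol, List.sum_eq_zero]
    simpa using fun a b hab => h0 _ hab
  rw [wordWeight, wordInv_of_pairwise h, h1, h2]
  simp

/-- Whatever its color, the new letter is below all of `w`. It is inverted with exactly the
`w.length - i` letters after it in the list and creates at most one descent, at that same position;
so `inv` and `maj` agree. -/
theorem wordWeight_insertLetter_of_pairwise (r i a z : ℕ) (e x : R) {w : List (ℕ × ℕ)}
    (h : w.Pairwise fun c d => d.1 < c.1) (h0 : ∀ c ∈ w, c.2 = 0) (ha : ∀ c ∈ w, a < c.1) :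
    wordWeight r e x (insertLetter i (a, z) w) = (e * x ^ r) ^ (w.length - i) * x ^ z := by
  have hcol : wordCol (insertLetter i (a, z) w) = z := by
    rw [wordCol_insertLetter, wordCol, List.sum_eq_zero, zero_add]
    simpa using fun a b hab => h0 _ hab
  have hinv : wordInv (insertLetter i (a, z) w) = w.length - i := by
    rw [insertLetter, wordInv_insert, List.take_append_drop, wordInv_of_pairwise h, zero_add,
      List.countP_eq_zero.2, List.countP_eq_length.2, List.length_drop, zero_add]
    · intro c hc
      simpa using ha c (List.mem_of_mem_drop hc)
    · intro c hc
      have := ha c (List.mem_of_mem_take hc)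
      simp only [decide_eq_true_eq]; omega
  have hlt : ∀ c ∈ w, ltF (a, z) c ∧ ¬ ltF c (a, z) := by
    intro c hc
    have := ha c hc
    have := h0 c hc
    simp only [ltF]; omega
  have hmaj : wordMaj (insertLetter i (a, z) w) = w.length - i := by
    clear hcol hinv
    induction w generalizing i with
    | nil => simp [insertLetter, wordMaj]
    | cons c w ih =>
      have hw : wordMaj (c :: w) = 0 := by
        apply wordMaj_of_isChain
        apply List.Pairwise.isChain
        apply h.imp_of_mem
        intro c d hc hd hcd
        have := h0 c hc
        have := h0 d hd
        simp only [ltF]; omega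
      cases i with
      | zero => simp [insertLetter_zero, wordMaj_cons_cons, hlt c (by simp), hw]
      | succ i =>
        have ih := ih i (List.pairwise_cons.1 h).2 (fun d hd => h0 d (List.mem_cons_of_mem _ hd))
          (fun d hd => ha d (List.mem_cons_of_mem _ hd))
          (fun d hd => hlt d (List.mem_cons_of_mem _ hd))
        rw [insertLetter_succ_cons, List.length_cons, Nat.add_sub_add_right, ← ih]
        cases i with
        | zero => simp [insertLetter_zero, wordMaj_cons_cons, hlt c (by simp)]
        | succ i =>
          cases w with
          | nil => simp [insertLetter, wordMaj, hlt c (by simp)]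
          | cons d w =>
            have : ¬ ltF c d := by
              have := (List.pairwise_cons.1 h).1 d (by simp)
              have := h0 c (by simp)
              have := h0 d (by simp)
              simp only [ltF]; omega
            simp [insertLetter_succ_cons, wordMaj_cons_cons, this]
  rw [wordWeight, hcol, hinv, hmaj]
  ring

theorem sum_wordWeight_extensions_singleton (r a : ℕ) (e x : R) {w : List (ℕ × ℕ)}
    (h : w.Pairwise fun c d => d.1 < c.1) (h0 : ∀ c ∈ w, c.2 = 0) (ha : ∀ c ∈ w, a < c.1) :
    ∑ u ∈ extensions r w [a], wordWeight r e x u =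
      (∑ i ∈ Finset.range (w.length + 1), (e * x ^ r) ^ i) * ∑ z ∈ Finset.range r, x ^ z := by
  rw [sum_extensions_cons]
  · simp only [extensions, Finset.sum_singleton,
      wordWeight_insertLetter_of_pairwise r _ a _ e x h h0 ha, ← Finset.mul_sum, ← Finset.sum_mul]
    rw [← Finset.sum_range_reflect]
    congr 1
    refine Finset.sum_congr rfl fun i hi => ?_
    rw [Finset.mem_range] at hi
    congr 1
    omega
  · simp only [List.nil_append, List.mem_map, not_exists, not_and]
    intro c hc h
    have := ha c hc
    omega

end Base

/-! ### From colored permutations to words. -/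

theorem reverse_ofFn_succ {n : ℕ} (f : Fin (n + 1) → ℕ × ℕ) : (List.ofFn f).reverse =
    f (Fin.last n) :: (List.ofFn fun i : Fin n => f i.castSucc).reverse := by
  rw [List.ofFn_succ', List.concat_eq_append, List.reverse_append]
  rfl

theorem countP_ofFn {α : Type*} {n : ℕ} (p : α → Bool) (f : Fin n → α) :
    (List.ofFn f).countP p = ∑ i, if p (f i) then 1 else 0 := by
  induction n with
  | zero => simp
  | succ n ih => rw [List.ofFn_succ, List.countP_cons, ih, Fin.sum_univ_succ, add_comm]

theorem wordInv_reverse_ofFn {n : ℕ} (f : Fin n → ℕ × ℕ) :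
    wordInv (List.ofFn f).reverse = (Finset.univ.filter fun p : Fin n × Fin n =>
      p.1 < p.2 ∧ (f p.1).1 > (f p.2).1).card := by
  rw [Finset.card_filter, Fintype.sum_prod_type]
  induction n with
  | zero => simp [wordInv]
  | succ n ih =>
    rw [reverse_ofFn_succ, wordInv, ih]
    simp only [Fin.sum_univ_castSucc, Fin.castSucc_lt_castSucc_iff, Fin.castSucc_lt_last,
      true_and, false_and, if_false, add_zero, Finset.sum_add_distrib,
      (Fin.le_last _).not_gt, Finset.sum_const_zero]
    rw [add_comm]
    congr 1
    rw [List.countP_reverse]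
    simp [countP_ofFn]

theorem wordMaj_reverse_ofFn {n : ℕ} (f : Fin n → ℕ × ℕ) :
    wordMaj (List.ofFn f).reverse = ∑ i ∈ Finset.univ.filter fun i : Fin n =>
      ∃ j : Fin n, j.val = i.val + 1 ∧ ltF (f j) (f i), (i.val + 1) := by
  rw [Finset.sum_filter]
  induction n with
  | zero => simp [wordMaj]
  | succ n ih =>
    cases n with
    | zero => simp [wordMaj]
    | succ n =>
      rw [Fin.sum_univ_castSucc, Fin.sum_univ_castSucc, reverse_ofFn_succ, reverse_ofFn_succ,
        wordMaj_cons_cons, ← reverse_ofFn_succ (fun i : Fin (n + 1) => f i.castSucc), ih,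
        Fin.sum_univ_castSucc]
      have h1 : ∀ i : Fin n, (∃ j : Fin (n + 1), j.val = i.castSucc.val + 1 ∧
          ltF (f j.castSucc) (f i.castSucc.castSucc)) ↔ ∃ j : Fin (n + 2),
          j.val = i.castSucc.castSucc.val + 1 ∧ ltF (f j) (f i.castSucc.castSucc) := by
        intro i
        constructor
        · rintro ⟨j, hj, h⟩
          exact ⟨j.castSucc, hj, h⟩
        · rintro ⟨j, hj, h⟩
          have hi := i.2
          refine ⟨⟨j, by simp at hj; omega⟩, hj, h⟩
      have h2 : (∃ j : Fin (n + 2), j.val = (Fin.last n).castSucc.val + 1 ∧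
          ltF (f j) (f (Fin.last n).castSucc)) ↔
          ltF (f (Fin.last (n + 1))) (f (Fin.last n).castSucc) := by
        constructor
        · rintro ⟨j, hj, h⟩
          rwa [show j = Fin.last (n + 1) from Fin.ext hj] at h
        · exact fun h => ⟨Fin.last (n + 1), rfl, h⟩
      have h3 : ¬ ∃ j : Fin (n + 1), j.val = (Fin.last n).val + 1 ∧
          ltF (f j.castSucc) (f (Fin.last n).castSucc) := by
        rintro ⟨j, hj, -⟩
        have := j.2
        simp at hj; omega
      have h4 : ¬ ∃ j : Fin (n + 2), j.val = (Fin.last (n + 1)).val + 1 ∧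
          ltF (f j) (f (Fin.last (n + 1))) := by
        rintro ⟨j, hj, -⟩
        have := j.2
        simp at hj; omega
      simp only [Fin.val_castSucc, Fin.val_last] at h1 h2 h3 h4 ⊢
      simp only [h1, h2, if_neg h3, if_neg h4, add_zero, List.length_reverse, List.length_ofFn]

theorem wordCol_reverse_ofFn {n : ℕ} (f : Fin n → ℕ × ℕ) :
    wordCol (List.ofFn f).reverse = ∑ i, (f i).2 := by
  rw [wordCol, List.map_reverse, List.sum_reverse, List.map_ofFn, List.sum_ofFn]
  rfl

variable {r n : ℕ}

theorem wordWeight_reverse_window {ζ ε : ℂ} (h : ℕ) (hζ : ζ ^ r = 1) (π : G r n) :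
    wordWeight r (C ε) (C (ζ ^ h) * X) (window π).reverse = C (chi ζ ε h π) * X ^ fmaj π := by
  rw [wordWeight, window, wordInv_reverse_ofFn, wordMaj_reverse_ofFn, wordCol_reverse_ofFn]
  change C ε ^ inv π * (C (ζ ^ h) * X) ^ fmaj π = _
  have : (ζ ^ h) ^ fmaj π = ζ ^ (h * col π) := by
    rw [fmaj, ← pow_mul, mul_add, pow_add, mul_left_comm, pow_mul, hζ, one_pow, one_mul]
  rw [mul_pow, ← C_pow, ← C_pow, this, chi, C_mul, mul_assoc]

theorem apply_eq_add (π : G r n) (a : Fin n) (i : ZMod r) :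
    π.1 (a, i) = ((π.1 (a, 0)).1, i + (π.1 (a, 0)).2) := π.2 a _ _ rfl i

theorem absVal_injective (π : G r n) : Function.Injective (absVal π) := by
  intro i j h
  have h1 : (π.1 (i, 0)).1 = (π.1 (j, 0)).1 := Fin.ext (by simpa [absVal] using h)
  have h2 : π.1 (j, (π.1 (i, 0)).2 - (π.1 (j, 0)).2) = π.1 (i, 0) := by
    rw [apply_eq_add, ← h1, sub_add_cancel]
  exact (congrArg Prod.fst (π.1.injective h2)).symm

theorem map_fst_window (π : G r n) : (window π).map Prod.fst = List.ofFn (absVal π) := by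
  rw [window, List.map_ofFn]; rfl

theorem map_fst_window_perm (π : G r n) :
    ((window π).map Prod.fst).Perm (List.range' 1 n) := by
  rw [map_fst_window]
  apply (List.Nodup.subperm (List.nodup_ofFn.2 (absVal_injective π)) _).perm_of_length_le (by simp)
  intro a ha
  obtain ⟨i, rfl⟩ := (List.mem_ofFn' _ _).1 ha
  simp only [absVal, List.mem_range'_1]
  omega

theorem window_injective [NeZero r] : Function.Injective (window : G r n → List (ℕ × ℕ)) := by
  intro π τ h
  have h1 := List.ofFn_injective h
  have h2 : ∀ i, π.1 (i, 0) = τ.1 (i, 0) := by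
    intro i
    have := congrFun h1 i
    simp only [absVal, color, Prod.mk.injEq, add_left_inj] at this
    exact Prod.ext (Fin.ext this.1) (ZMod.val_injective r this.2)
  apply Subtype.ext
  apply Equiv.ext
  rintro ⟨a, i⟩
  rw [apply_eq_add, apply_eq_add τ, h2]

theorem exists_window_eq [NeZero r] {u : List (ℕ × ℕ)}
    (h : (u.map Prod.fst).Perm (List.range' 1 n)) (hr : ∀ c ∈ u, c.2 < r) :
    ∃ π : G r n, window π = u := by
  have hlen : u.length = n := by simpa using h.length_eq
  subst hlen
  have hv : ∀ i : Fin u.length, 1 ≤ (u[i]).1 ∧ (u[i]).1 - 1 < u.length := by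
    intro i
    have := h.mem_iff.1 (List.mem_map_of_mem (f := Prod.fst) (List.getElem_mem i.2))
    rw [List.mem_range'_1] at this
    simp only [Fin.getElem_fin]
    omega
  have hnd : (u.map Prod.fst).Nodup := h.nodup_iff.2 List.nodup_range'
  let f : Fin u.length × ZMod r → Fin u.length × ZMod r := fun p =>
    (⟨(u[p.1]).1 - 1, (hv p.1).2⟩, p.2 + ((u[p.1]).2 : ZMod r))
  have hf : Function.Injective f := by
    rintro ⟨a, i⟩ ⟨b, j⟩ hab
    simp only [f, Prod.mk.injEq, Fin.mk.injEq] at hab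
    have hab1 : a = b := by
      have := hv a
      have := hv b
      have h3 : (u[a]).1 = (u[b]).1 := by omega
      have := (List.Nodup.getElem_inj_iff hnd (i := a) (j := b) (hi := by simp) (hj := by simp)).1
        (by simpa using h3)
      exact Fin.ext this
    subst hab1
    simpa using hab.2
  let e : Equiv.Perm (Fin u.length × ZMod r) := Equiv.ofBijective f (Finite.injective_iff_bijective.1 hf)
  have he : ∀ a i, e (a, i) = (⟨(u[a]).1 - 1, (hv a).2⟩, i + ((u[a]).2 : ZMod r)) := fun _ _ => rfl
  refine ⟨⟨e, ?_⟩, ?_⟩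
  · intro a b j hab i
    rw [he, Prod.mk.injEq, zero_add] at hab
    rw [he, hab.1, hab.2]
  · apply List.ext_getElem (by simp [window])
    intro i h1 h2
    simp only [window, List.getElem_ofFn, absVal, color, he]
    refine Prod.ext ?_ ?_
    · exact Nat.sub_add_cancel (hv ⟨i, h2⟩).1
    · simp only [zero_add]
      exact ZMod.val_cast_of_lt (hr _ (List.getElem_mem h2))

/-- `L` may list the missing values in any order; this freedom allows insertion in adjacent pairs.
-/
theorem sum_withSubseq [NeZero r] {M : Type*} [AddCommMonoid M] {a b : ℕ} (L : List ℕ)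
    (hL : (L ++ (List.range' a (b + 1 - a)).reverse).Perm (List.range' 1 n))
    (f : List (ℕ × ℕ) → M) :
    ∑ π ∈ withSubseq r n a b, f (window π).reverse =
      ∑ w ∈ extensions r ((List.range' a (b + 1 - a)).map fun m => (m, 0)).reverse L, f w := by
  set B := (List.range' a (b + 1 - a)).map fun m => (m, 0) with hB
  have hval : B.reverse.map Prod.fst = (List.range' a (b + 1 - a)).reverse := by
    simp [hB, List.map_reverse, Function.comp_def]
  have hmem := fun w => mem_extensions_iff (r := r) (w₀ := B.reverse) (w := w) (L := L)
    (by rw [hval]; exact hL.nodup_iff.2 List.nodup_range')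
    (by
      intro c hc
      simp only [hB, List.mem_reverse, List.mem_map] at hc
      obtain ⟨m, -, rfl⟩ := hc
      exact Nat.pos_of_neZero r)
  rw [hval] at hmem
  have hsub : ∀ π : G r n, π ∈ withSubseq r n a b ↔ B.Sublist (window π) := by
    intro π
    simp [withSubseq, hB]
  apply Finset.sum_nbij fun π => (window π).reverse
  · intro π hπ
    rw [hmem]
    refine ⟨List.reverse_sublist.2 ((hsub π).1 hπ), ?_, ?_⟩
    · rw [List.map_reverse]
      exact (List.reverse_perm _).trans ((map_fst_window_perm π).trans hL.symm)
    · intro c hc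
      rw [List.mem_reverse, window, List.mem_ofFn'] at hc
      obtain ⟨i, rfl⟩ := hc
      exact ZMod.val_lt _
  · exact (List.reverse_injective.comp window_injective).injOn
  · intro w hw
    obtain ⟨h1, h2, h3⟩ := (hmem w).1 hw
    obtain ⟨π, hπ⟩ := exists_window_eq (n := n) (u := w.reverse)
      (by rw [List.map_reverse]; exact (List.reverse_perm _).trans (h2.trans hL))
      (fun c hc => h3 c (List.mem_reverse.1 hc))
    refine ⟨π, ?_, by simp [hπ]⟩
    rw [Finset.mem_coe, hsub, hπ]
    simpa using List.reverse_sublist.2 h1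
  · intro π _
    rfl

/-! ### Pairing the missing values and conclusion. -/

theorem flatMap_pairs_perm (c m : ℕ) :
    (((List.range m).map fun j => c + 2 * j).flatMap fun a => [a + 1, a]).Perm
      (List.range' c (2 * m)) := by
  induction m with
  | zero => simp
  | succ m ih =>
    rw [List.range_succ, List.map_append, List.flatMap_append, mul_add, ← List.range'_append_1]
    apply ih.append
    simpa [List.range'] using List.Perm.swap _ _ _

end ColoredPermutation

open ColoredPermutation in
theorem theorem2p2 (r n k b h : ℕ) [NeZero r] (ζ ε : ℂ)
    (hζ : IsPrimitiveRoot ζ r) (hε : ε = 1 ∨ ε = -1) (hh : h < r)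
    (hk : 1 ≤ k) (hkn : k ≤ n - 1) (hkb : k ≤ b) (hbn : b ≤ n) (hb : b ≡ n [MOD 2]) :
    (Even (n - k) →
      ∑ π ∈ ColoredPermutation.withSubseq r n (b - k + 1) b,
          C (ColoredPermutation.chi ζ ε h π) * X ^ ColoredPermutation.fmaj π =
        ∏ i ∈ Finset.Icc (k + 1) n,
          ColoredPermutation.qInt (i * r) (C (ε ^ (i - 1) * ζ ^ h) * X)) ∧
    (Odd (n - k) →
      ∑ π ∈ ColoredPermutation.withSubseq r n (b - k + 1) b,
          C (ColoredPermutation.chi ζ ε h π) * X ^ ColoredPermutation.fmaj π =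
        (ColoredPermutation.qInt (k + 1) (C ε * X ^ r) *
            ColoredPermutation.qInt r (C (ζ ^ h) * X)) *
          ∏ i ∈ Finset.Icc (k + 2) n,
            ColoredPermutation.qInt (i * r) (C (ε ^ (i - 1) * ζ ^ h) * X)) := by
  have hb' : b % 2 = n % 2 := hb
  have hx : ((C (ζ ^ h) * X : ℂ[X]) ^ 2) ^ r ≠ 1 := by
    intro hx
    -- The power has zero constant term because `r` is nonzero.
    have := congrArg (Polynomial.eval 0) hx
    simp [NeZero.ne r] at this
  have hxr : (C (ζ ^ h) * X : ℂ[X]) ^ r = X ^ r := by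
    rw [mul_pow, ← C_pow, ← pow_mul, mul_comm h, pow_mul, hζ.pow_eq_one, one_pow, C_1, one_mul]
  have hε' : (C ε : ℂ[X]) = 1 ∨ (C ε : ℂ[X]) = -1 := by
    rcases hε with rfl | rfl <;> simp
  have hq : ∀ i, qInt (i * r) (C (ε ^ (i - 1) * ζ ^ h) * X) =
      ∑ j ∈ Finset.range (i * r), ((C ε : ℂ[X]) ^ (i - 1) * (C (ζ ^ h) * X)) ^ j := by
    intro i
    rw [qInt, C_mul, C_pow, mul_assoc]
  simp only [hq, ← wordWeight_reverse_window h hζ.pow_eq_one]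
  have hbk : b + 1 - (b - k + 1) = k := by omega
  set w₀ := ((List.range' (b - k + 1) k).map fun m => (m, 0)).reverse with hw₀
  have hval : w₀.map Prod.fst = (List.range' (b - k + 1) k).reverse := by
    simp [hw₀, List.map_reverse, Function.comp_def]
  have hlen : w₀.length = k := by simp [hw₀]
  have hpair : w₀.Pairwise fun c d => d.1 < c.1 := by
    rw [hw₀, List.pairwise_reverse, List.pairwise_map]
    exact List.pairwise_lt_range'
  have hzero : ∀ c ∈ w₀, c.2 = 0 := by
    intro c hc
    simp only [hw₀, List.mem_reverse, List.mem_map] at hc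
    obtain ⟨m, -, rfl⟩ := hc
    rfl
  have hsplit : ∀ m l, m + l = b - k → (List.range' 1 m ++ List.range' (b + 1) (n - b) ++
      List.range' (m + 1) l ++ (List.range' (b - k + 1) k).reverse).Perm (List.range' 1 n) := by
    intro m l hml
    have h1 : List.range' 1 n = List.range' 1 m ++ (List.range' (m + 1) l ++
        (List.range' (b - k + 1) k ++ List.range' (b + 1) (n - b))) := by
      have e1 := List.range'_append_1 (s := b - k + 1) (m := k) (n := n - b)
      rw [show b - k + 1 + k = b + 1 by omega] at e1
      have e2 := List.range'_append_1 (s := m + 1) (m := l) (n := k + (n - b))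
      rw [show m + 1 + l = b - k + 1 by omega] at e2
      have e3 := List.range'_append_1 (s := 1) (m := m) (n := l + (k + (n - b)))
      rw [add_comm 1 m] at e3
      rw [e1, e2, e3]
      congr 1
      omega
    rw [h1, List.append_assoc, List.append_assoc]
    apply List.Perm.append_left
    refine List.perm_append_comm.trans ?_
    rw [List.append_assoc]
    exact ((List.reverse_perm _).append_right _).append_left _
  -- The lower members of the pairs: `m` pairs from `1` upwards, and all the values above `b`, whose
  -- number is even.
  set P : ℕ → List ℕ := fun m => ((List.range m).map fun j => 1 + 2 * j) ++
    (List.range ((n - b) / 2)).map fun j => b + 1 + 2 * j with hP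
  have hPperm : ∀ m, ((P m).flatMap fun a => [a + 1, a]).Perm
      (List.range' 1 (2 * m) ++ List.range' (b + 1) (n - b)) := by
    intro m
    rw [hP, List.flatMap_append]
    have := flatMap_pairs_perm (b + 1) ((n - b) / 2)
    rw [show 2 * ((n - b) / 2) = n - b by omega] at this
    exact (flatMap_pairs_perm 1 m).append this
  have main : ∀ m L, 2 * m + L.length = b - k → L = List.range' (2 * m + 1) L.length →
      ∑ π ∈ withSubseq r n (b - k + 1) b,
        wordWeight r (C ε) (C (ζ ^ h) * X) (window π).reverse =
      (∑ w ∈ extensions r w₀ L, wordWeight r (C ε) (C (ζ ^ h) * X) w) *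
        ∏ i ∈ Finset.Icc (L.length + k + 1) n, ∑ j ∈ Finset.range (i * r),
          ((C ε : ℂ[X]) ^ (i - 1) * (C (ζ ^ h) * X)) ^ j := by
    intro m L hm hL
    have hperm : ((P m).flatMap (fun a => [a + 1, a]) ++ L ++
        (List.range' (b - k + 1) k).reverse).Perm (List.range' 1 n) := by
      refine List.Perm.trans ?_ (hsplit (2 * m) L.length hm)
      rw [← hL]
      exact ((hPperm m).append_right _).append_right _
    have h1 := sum_withSubseq (r := r) (n := n) (a := b - k + 1) (b := b)
      ((P m).flatMap (fun a => [a + 1, a]) ++ L) (by rwa [hbk])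
      (wordWeight r (C ε) (C (ζ ^ h) * X))
    rw [hbk] at h1
    rw [h1, sum_wordWeight_extensions_pairs hε' hx (P m)
      (by rw [hval]; exact hperm.nodup_iff.2 List.nodup_range'), hlen]
    congr 3
    have : (P m).length = m + (n - b) / 2 := by simp [hP]
    omega
  constructor
  · intro hev
    have hev' := Nat.even_iff.1 hev
    rw [main ((b - k) / 2) [] (by simp; omega) rfl]
    simp [extensions, wordWeight_of_pairwise r _ _ hpair hzero]
  · intro hodd
    have hodd' := Nat.odd_iff.1 hodd
    -- Here `b - k` is odd and its own value is left over; it is smaller than every letter of the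
    -- block.
    rw [main ((b - k) / 2) [b - k] (by simp; omega) (by simp; omega)]
    rw [sum_wordWeight_extensions_singleton r _ _ _ hpair hzero, hlen, hxr, qInt, qInt,
      List.length_singleton, show 1 + k + 1 = k + 2 by omega]
    intro c hc
    have := List.mem_map_of_mem (f := Prod.fst) hc
    rw [hval, List.mem_reverse, List.mem_range'_1] at this
    omega
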